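/- Let $\theta\in\mathbb R$, $\sigma_\theta,\sigma_\epsilon>0$ and $p>0$. Write $\Phi,\phi$ for the standard normal distribution function and density, and put $$\sigma=\sqrt{\sigma_\epsilon^2+\sigma_\theta^2},\qquad \tau=\frac{\sigma_\theta^2}{\sigma_\epsilon^2+\sigma_\theta^2},\qquad \sigma_v=\frac{\sigma_\epsilon\sigma_\theta}{\sqrt{\sigma_\epsilon^2+\sigma_\theta^2}},\qquad \mu_x=\tau x+(1-\tau)\theta .$$ A product of price $p$ has random quality $v\sim N(\theta,\sigma_\theta^2)$. Consumers have valuations $v_i=v+\epsilon_i$ with $\epsilon_i\sim N(0,\sigma_\epsilon^2)$, so that $v$ given $v_i=x$ has law $N(\mu_x,\sigma_v^2)$, and each buyer receives the reward $\hat r(v)$. A number $c\in\mathbb R$ is an equilibrium cutoff for $\hat r$ if, for every $x\in\mathbb R$, the expected payoff $x-p+\mathbb E[\hat r(v)\mid v_i=x]$ of buying is positive exactly when $x>c$. The firm's expected profit is then $\Pi(\hat r,c)=\mathbb E_v\big[(p-\hat r(v))\,\Phi(\tfrac{v-c}{\sigma_\epsilon})\big]$. Call $(\hat r,c)$ feasible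 if $\hat r:\mathbb R\to[0,p]$ is continuous and piecewise continuously differentiable (with finitely many pieces on each bounded interval), $|\hat r'(v)|\le 1/\tau$ wherever the derivative exists, and $c$ is an equilibrium cutoff for $\hat r$. Call it optimal if it maximizes $\Pi$ over all feasible pairs. Then an optimal pair exists, and for every optimal pair $(\hat r^*,c)$ there are $v_L,v_H\in\mathbb R$ with $$\hat r^*(v)=\begin{cases}p, & v<v_L,\\ p-\frac1\tau(v-v_L), & v_L\le v<v_H,\\ 0,& v_H\le v,\end{cases}$$ where $(c,v_L,v_H)$ solves the system $$\frac{\int_{v_L}^{v_H}\Phi(\frac{w-c}{\sigma_\epsilon})\,\frac{1}{\sigma_\theta}\phi(\frac{\theta-w}{\sigma_\theta})\,dw}{\Phi(\frac{v_H-\mu_c}{\sigma_v})-\Phi(\frac{v_L-\mu_c}{\sigma_v})}=\frac{c\,\frac1\sigma\phi(\frac{\theta-c}{\sigma})}{1+\Phi(\frac{v_L-\mu_c}{\sigma_v})-\Phi(\frac{v_H-\mu_c}{\sigma_v})},\qquad v_H-v_L=\tau p,$$ $$p=c+\frac{\sigma_v}{\tau}\Big(\tfrac{v_H-\mu_c}{\sigma_v}\Phi(\tfrac{v_H-\mu_c}{\sigma_v})-\tfrac{v_L-\mu_c}{\sigma_v}\Phi(\tfrac{v_L-\mu_c}{\sigma_v})+\phi(\tfrac{v_H-\mu_c}{\sigma_v})-\phi(\tfrac{v_L-\mu_c}{\sigma_v})\Big).$$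 -/

import Mathlib

open MeasureTheory ProbabilityTheory Filter Topology

noncomputable section

namespace RewardProgram

/-- Standard normal cumulative distribution function. -/
def Phi (x : ℝ) : ℝ := cdf (gaussianReal 0 1) x

/-- Standard normal density. -/
def phi (x : ℝ) : ℝ := gaussianPDFReal 0 1 x

/-- The normal law with mean `m` and standard deviation `s`. -/
def normalLaw (m s : ℝ) : Measure ℝ := gaussianReal m ⟨s ^ 2, sq_nonneg s⟩

/-- The data of the model: the quality is `v ∼ N(θ, σθ²)`, consumer `i` values the product at
`v + ε_i` with `ε_i ∼ N(0, σε²)`, and the product is sold at price `p`. -/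
structure Market where
  θ : ℝ
  σθ : ℝ
  σε : ℝ
  p : ℝ

namespace Market

variable (M : Market)

/-- Total uncertainty (standard deviation of a consumer's valuation). -/
def σ : ℝ := Real.sqrt (M.σε ^ 2 + M.σθ ^ 2)

/-- Weight of the own valuation in the posterior mean of the quality. -/
def τ : ℝ := M.σθ ^ 2 / (M.σε ^ 2 + M.σθ ^ 2)

/-- Posterior standard deviation of the quality. -/
def σv : ℝ := M.σε * M.σθ / Real.sqrt (M.σε ^ 2 + M.σθ ^ 2)

/-- Posterior mean of the quality, given the valuation `x`. -/
def μ (x : ℝ) : ℝ := M.τ * x + (1 - M.τ) * M.θ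

/-- Law of the quality. -/
def qualityLaw : Measure ℝ := normalLaw M.θ M.σθ

/-- Law of the quality, given that a consumer's valuation is `x`. -/
def posterior (x : ℝ) : Measure ℝ := normalLaw (M.μ x) M.σv

/-- Mass of buyers at quality `v`, when consumers buy iff their valuation exceeds `c`. -/
def salesVolume (c v : ℝ) : ℝ := Phi ((v - c) / M.σε)

/-- Expected payoff from buying of a consumer with valuation `x`, under the reward `r` (as a
function of the realized quality). -/
def payoff (r : ℝ → ℝ) (x : ℝ) : ℝ := x - M.p + ∫ v, r v ∂(M.posterior x)

/-- Buying iff the valuation exceeds `c` is an equilibrium: given the reward `r`, the consumers whose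
expected payoff from buying is positive are exactly those with valuation above `c`. -/
def IsEquilibriumCutoff (r : ℝ → ℝ) (c : ℝ) : Prop := ∀ x : ℝ, 0 < M.payoff r x ↔ c < x

/-- Expected profit of the firm under reward `r`, when consumers use the cutoff `c`. -/
def profit (r : ℝ → ℝ) (c : ℝ) : ℝ := ∫ v, (M.p - r v) * M.salesVolume c v ∂M.qualityLaw

end Market

/-- Continuous and piecewise continuously differentiable, with finitely many pieces on every bounded
interval; at the break points the derivative has one-sided limits. -/
def IsPiecewiseC1 (f : ℝ → ℝ) : Prop :=
  Continuous f ∧ ∃ S : Set ℝ, (∀ a b : ℝ, (S ∩ Set.Icc a b).Finite) ∧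
    (∀ x, x ∉ S → ContDiffAt ℝ 1 f x) ∧
    ∀ x ∈ S, (∃ l, Tendsto (deriv f) (𝓝[<] x) (𝓝 l)) ∧ (∃ l, Tendsto (deriv f) (𝓝[>] x) (𝓝 l))

namespace Market

variable (M : Market)

/-- Rate-constrained reward programs. -/
structure IsRateConstrained (r : ℝ → ℝ) : Prop where
  mem_range : ∀ v, r v ∈ Set.Icc 0 M.p
  piecewiseC1 : IsPiecewiseC1 r
  rate : ∀ v, DifferentiableAt ℝ r v → |deriv r v| ≤ 1 / M.τ

/-- A rate-constrained reward program together with an equilibrium cutoff. -/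
def IsFeasible (r : ℝ → ℝ) (c : ℝ) : Prop := M.IsRateConstrained r ∧ M.IsEquilibriumCutoff r c

/-- A feasible pair of largest expected profit. -/
def IsOptimal (r : ℝ → ℝ) (c : ℝ) : Prop :=
  M.IsFeasible r c ∧ ∀ r' c', M.IsFeasible r' c' → M.profit r' c' ≤ M.profit r c

/-- The saturated linear reward program. -/
def saturatedLinear (vL vH v : ℝ) : ℝ :=
  if v < vL then M.p else if v < vH then M.p - 1 / M.τ * (v - vL) else 0

/-- The system of equations for the cutoff `c` and the two kinks `vL`, `vH`. -/
structure SolvesSystem (c vL vH : ℝ) : Prop where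
  stationarity :
    (∫ w in vL..vH, Phi ((w - c) / M.σε) * (phi ((M.θ - w) / M.σθ) / M.σθ)) /
        (Phi ((vH - M.μ c) / M.σv) - Phi ((vL - M.μ c) / M.σv)) =
      c * (phi ((M.θ - c) / M.σ) / M.σ) /
        (1 + Phi ((vL - M.μ c) / M.σv) - Phi ((vH - M.μ c) / M.σv))
  width : vH - vL = M.τ * M.p
  indifference :
    M.p = c + M.σv / M.τ *
      ((vH - M.μ c) / M.σv * Phi ((vH - M.μ c) / M.σv) -
        (vL - M.μ c) / M.σv * Phi ((vL - M.μ c) / M.σv) +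
        phi ((vH - M.μ c) / M.σv) - phi ((vL - M.μ c) / M.σv))

end Market

end RewardProgram

end

/-! Fix the cutoff `c` and compare programs sharing it. Since the payoff is continuous, the marginal
consumer is indifferent, so every program `r` with cutoff `c` has posterior mean `p - c` at `x = c`.
For `0 < c < p` some ramp `R` (value `p`, then descent at the maximal rate `1/τ`, then `0`) has the
same cutoff. As no program falls faster, `r - R` changes sign once, from nonpositive to nonnegative,
at some `v₀`.

By Bayes' rule, the prior density times `phi ((v - c) / σε)` is proportional to the posterior
density at `c`. Hence `r - R` integrates to `0` against that weight, and the loss from using `r` is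
the prior mean of `(r - R) (Phi - k phi)`, with `Phi` and `phi` taken at `(v - c) / σε`, for any
constant `k`. Since `Phi / phi` is strictly increasing, taking for `k` its value at `v₀` makes the
integrand nonnegative, so the ramp is at least as profitable, with equality only for `r = R`
(`IsFeasible.profit_le_rampProfit`).

What remains is one variable: the distance `a` from the marginal posterior mean to the start of the
ramp. The profit is differentiable in `a` (`hasDerivAt_rampProfit`), strictly increasing near `-∞`
and strictly decreasing near `+∞`, so a maximum exists and strictly beats the boundary cases `c = p`
(no reward) and `c = 0` (zero profit). Vanishing of the derivative is the stationarity equation. -/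

noncomputable section

namespace RewardProgram

/-! ### The normal law and the monotone ratio `Phi / phi`. -/

section Normal

theorem phi_eq (x : ℝ) : phi x = (√(2 * Real.pi))⁻¹ * Real.exp (-x ^ 2 / 2) := by
  simp [phi, gaussianPDFReal]

theorem phi_pos (x : ℝ) : 0 < phi x := gaussianPDFReal_pos 0 1 x one_ne_zero

theorem phi_neg (x : ℝ) : phi (-x) = phi x := by simp [phi_eq]

theorem phi_sub_comm_div (x y s : ℝ) : phi ((x - y) / s) = phi ((y - x) / s) := by
  rw [← phi_neg, ← neg_div, neg_sub]

theorem phi_le_phi_zero (x : ℝ) : phi x ≤ phi 0 := by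
  rw [phi_eq, phi_eq]
  refine mul_le_mul_of_nonneg_left (Real.exp_le_exp.2 ?_) (by positivity)
  linarith [sq_nonneg x]

theorem hasDerivAt_phi (x : ℝ) : HasDerivAt phi (-x * phi x) x := by
  have h : HasDerivAt (fun x : ℝ => (√(2 * Real.pi))⁻¹ * Real.exp (-x ^ 2 / 2))
      ((√(2 * Real.pi))⁻¹ * (Real.exp (-x ^ 2 / 2) * (-(2 * x) / 2))) x := by
    have h1 : HasDerivAt (fun x : ℝ => -x ^ 2 / 2) (-(2 * x) / 2) x := by
      simpa using ((hasDerivAt_pow 2 x).neg.div_const 2)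
    exact h1.exp.const_mul _
  have e : phi = fun x : ℝ => (√(2 * Real.pi))⁻¹ * Real.exp (-x ^ 2 / 2) := funext phi_eq
  rw [e]
  convert h using 1
  ring

theorem continuous_phi : Continuous phi :=
  continuous_iff_continuousAt.2 fun x => (hasDerivAt_phi x).continuousAt

theorem integrable_phi : Integrable phi := integrable_gaussianPDFReal 0 1

theorem Phi_eq_integral (x : ℝ) : Phi x = ∫ t in Set.Iic x, phi t := by
  rw [Phi, cdf_eq_real, measureReal_def, gaussianReal_apply_eq_integral _ one_ne_zero,
    ENNReal.toReal_ofReal]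
  · rfl
  · exact integral_nonneg fun t => (phi_pos t).le

theorem Phi_sub_eq_integral (x y : ℝ) : Phi y - Phi x = ∫ t in x..y, phi t := by
  rw [Phi_eq_integral, Phi_eq_integral]
  exact intervalIntegral.integral_Iic_sub_Iic integrable_phi.integrableOn
    integrable_phi.integrableOn

theorem hasDerivAt_Phi (x : ℝ) : HasDerivAt Phi (phi x) x := by
  have h : HasDerivAt (fun y => Phi 0 + ∫ t in (0 : ℝ)..y, phi t) (phi x) x :=
    (intervalIntegral.integral_hasDerivAt_right (continuous_phi.intervalIntegrable _ _)
      (continuous_phi.stronglyMeasurableAtFilter _ _)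
      continuous_phi.continuousAt).const_add _
  convert h using 1
  ext y
  rw [← Phi_sub_eq_integral]; ring

theorem continuous_Phi : Continuous Phi :=
  continuous_iff_continuousAt.2 fun x => (hasDerivAt_Phi x).continuousAt

theorem strictMono_Phi : StrictMono Phi :=
  strictMono_of_deriv_pos fun x => by rw [(hasDerivAt_Phi x).deriv]; exact phi_pos x

theorem Phi_nonneg (x : ℝ) : 0 ≤ Phi x := cdf_nonneg _ x

theorem Phi_le_one (x : ℝ) : Phi x ≤ 1 := cdf_le_one _ x

theorem Phi_pos (x : ℝ) : 0 < Phi x :=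
  (Phi_nonneg (x - 1)).trans_lt (strictMono_Phi (by linarith))

theorem Phi_lt_one (x : ℝ) : Phi x < 1 :=
  (strictMono_Phi (lt_add_one x)).trans_le (Phi_le_one (x + 1))

theorem tendsto_Phi_atBot : Tendsto Phi atBot (𝓝 0) := tendsto_cdf_atBot _

theorem tendsto_Phi_atTop : Tendsto Phi atTop (𝓝 1) := tendsto_cdf_atTop _

theorem lipschitzWith_Phi : LipschitzWith (NNReal.mk (phi 0) (phi_pos 0).le) Phi :=
  lipschitzWith_of_nnnorm_deriv_le (fun x => (hasDerivAt_Phi x).differentiableAt) fun x => by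
    rw [(hasDerivAt_Phi x).deriv, ← NNReal.coe_le_coe, coe_nnnorm, Real.norm_eq_abs,
      abs_of_pos (phi_pos x)]
    exact phi_le_phi_zero x

theorem hasDerivAt_mul_Phi_add_phi (x : ℝ) :
    HasDerivAt (fun x => x * Phi x + phi x) (Phi x) x :=
  (((hasDerivAt_id x).mul (hasDerivAt_Phi x)).add (hasDerivAt_phi x)).congr_deriv
    (by simp only [id_eq]; ring)

theorem integrable_mul_phi : Integrable fun t => -t * phi t := by
  have h := ((integrable_mul_exp_neg_mul_sq (b := 1 / 2) (by norm_num)).const_mul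
    (-(√(2 * Real.pi))⁻¹))
  convert h using 2 with t
  rw [phi_eq]; ring_nf

theorem tendsto_phi_atBot : Tendsto phi atBot (𝓝 0) := by
  have e : phi = fun x : ℝ => (√(2 * Real.pi))⁻¹ * Real.exp (-(x ^ 2 / 2)) := by
    ext x; rw [phi_eq, neg_div]
  rw [e, ← mul_zero (√(2 * Real.pi))⁻¹]
  refine Tendsto.const_mul _ (Real.tendsto_exp_neg_atTop_nhds_zero.comp ?_)
  exact Tendsto.atTop_div_const (by norm_num)
    ((tendsto_pow_atTop two_ne_zero).comp tendsto_neg_atBot_atTop |>.congr fun x => by simp)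

theorem mul_Phi_add_phi_eq_integral (x : ℝ) :
    x * Phi x + phi x = ∫ t in Set.Iic x, (x - t) * phi t := by
  have h : ∫ t in Set.Iic x, -t * phi t = phi x - 0 :=
    integral_Iic_of_hasDerivAt_of_tendsto' (fun t _ => hasDerivAt_phi t)
      integrable_mul_phi.integrableOn tendsto_phi_atBot
  rw [Phi_eq_integral, ← integral_const_mul, ← sub_zero (phi x), ← h,
    ← integral_add (integrable_phi.const_mul x).integrableOn integrable_mul_phi.integrableOn]
  congr 1 with t
  ring

/-- The derivative `Phi` is positive, so the value at `x` strictly exceeds the one at `x - 1`, which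
is the integral of a nonnegative function. -/
theorem mul_Phi_add_phi_pos (x : ℝ) : 0 < x * Phi x + phi x := by
  have hm : StrictMono fun x => x * Phi x + phi x :=
    strictMono_of_deriv_pos fun x => by
      rw [(hasDerivAt_mul_Phi_add_phi x).deriv]; exact Phi_pos x
  refine lt_of_le_of_lt ?_ (hm (sub_one_lt x))
  simp only [mul_Phi_add_phi_eq_integral]
  exact setIntegral_nonneg measurableSet_Iic fun t ht =>
    mul_nonneg (sub_nonneg.2 ht) (phi_pos t).le

/-- The numerator of the derivative is `phi x * (x * Phi x + phi x)`. This monotonicity drives both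
the comparison of programs and the tail estimates of the profit. -/
theorem strictMono_Phi_div_phi : StrictMono fun x => Phi x / phi x :=
  strictMono_of_deriv_pos fun x => by
    rw [((hasDerivAt_Phi x).fun_div (hasDerivAt_phi x) (phi_pos x).ne').deriv]
    have h1 := mul_Phi_add_phi_pos x
    have h2 := phi_pos x
    apply div_pos _ (by positivity)
    nlinarith

theorem Phi_div_phi_lt {x : ℝ} (hx : x < 0) : Phi x / phi x < (-x)⁻¹ := by
  rw [div_lt_iff₀ (phi_pos x), inv_mul_eq_div, lt_div_iff₀ (by linarith)]
  linarith [mul_Phi_add_phi_pos x]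

theorem integral_Phi_div {s : ℝ} (hs : 0 < s) (a b : ℝ) :
    ∫ w in a..b, Phi (w / s) =
      s * (b / s * Phi (b / s) - a / s * Phi (a / s) + phi (b / s) - phi (a / s)) := by
  have := intervalIntegral.integral_comp_div (f := Phi) (a := a) (b := b) hs.ne'
  rw [this, intervalIntegral.integral_eq_sub_of_hasDerivAt
    (fun x _ => hasDerivAt_mul_Phi_add_phi x) (continuous_Phi.intervalIntegrable _ _), smul_eq_mul]
  ring

theorem gaussianPDFReal_eq_phi {s : ℝ} (hs : 0 < s) (m x : ℝ) :
    gaussianPDFReal m (NNReal.mk (s ^ 2) (sq_nonneg s)) x = phi ((x - m) / s) / s := by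
  rw [phi_eq, gaussianPDFReal_def, NNReal.coe_mk, Real.sqrt_mul' _ (sq_nonneg s), Real.sqrt_sq hs.le]
  field_simp

theorem normalLaw_def (m s : ℝ) :
    normalLaw m s = gaussianReal m (NNReal.mk (s ^ 2) (sq_nonneg s)) := rfl

instance isProbabilityMeasure_normalLaw (m s : ℝ) : IsProbabilityMeasure (normalLaw m s) := by
  rw [normalLaw_def]; infer_instance

theorem variance_ne_zero {s : ℝ} (hs : 0 < s) : NNReal.mk (s ^ 2) (sq_nonneg s) ≠ 0 := by
  intro h
  exact hs.ne' (pow_eq_zero_iff two_ne_zero |>.1 (congrArg NNReal.toReal h))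

theorem integral_normalLaw {s : ℝ} (hs : 0 < s) (m : ℝ) (u : ℝ → ℝ) :
    ∫ v, u v ∂normalLaw m s = ∫ v, phi ((v - m) / s) / s * u v := by
  rw [normalLaw_def, integral_gaussianReal_eq_integral_smul (variance_ne_zero hs)]
  simp only [gaussianPDFReal_eq_phi hs, smul_eq_mul]

theorem normalLaw_eq_map (m s : ℝ) :
    normalLaw m s = (gaussianReal 0 1).map fun z => m + s * z := by
  have h1 := gaussianReal_map_const_mul (μ := 0) (v := 1) s
  have h2 := gaussianReal_map_const_add (μ := s * 0) (v := (NNReal.mk (s ^ 2) (sq_nonneg s)) * 1) m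
  rw [← h1, Measure.map_map (by fun_prop) (by fun_prop)] at h2
  rw [normalLaw_def]
  convert h2.symm using 2
  · simp
  · simp
  · rfl

theorem normalLaw_real_Iic {s : ℝ} (hs : 0 < s) (m w : ℝ) :
    (normalLaw m s).real (Set.Iic w) = Phi ((w - m) / s) := by
  rw [normalLaw_eq_map, map_measureReal_apply (by fun_prop) measurableSet_Iic, Phi, cdf_eq_real]
  congr 1
  ext z
  simp only [Set.mem_preimage, Set.mem_Iic]
  rw [le_div_iff₀ hs]
  constructor <;> intro h <;> linarith

theorem nullSingletonClass_normalLaw {s : ℝ} (hs : 0 < s) (m : ℝ) : NullSingletonClass (normalLaw m s) :=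
  nullSingletonClass_gaussianReal (variance_ne_zero hs)

theorem isOpenPosMeasure_normalLaw {s : ℝ} (hs : 0 < s) (m : ℝ) :
    (normalLaw m s).IsOpenPosMeasure :=
  (gaussianReal_absolutelyContinuous' m (variance_ne_zero hs)).isOpenPosMeasure

end Normal

/-- The break points are countable, so the fundamental theorem of calculus with a countable
exceptional set applies; the bound `K` makes the derivative integrable. -/
theorem IsPiecewiseC1.sub_eq_integral_deriv {f : ℝ → ℝ} (hf : IsPiecewiseC1 f) {K : ℝ}
    (hK : ∀ x, |deriv f x| ≤ K) (a b : ℝ) : f b - f a = ∫ x in a..b, deriv f x := by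
  obtain ⟨hc, S, hS, hd, -⟩ := hf
  have hScount : S.Countable := by
    have : S = ⋃ n : ℕ, S ∩ Set.Icc (-(n : ℝ)) n := by
      ext x
      simp only [Set.mem_iUnion, Set.mem_inter_iff, Set.mem_Icc, ← abs_le, exists_and_left]
      exact ⟨fun h => ⟨h, exists_nat_ge |x|⟩, fun h => h.1⟩
    rw [this]
    exact Set.countable_iUnion fun n => (hS _ _).countable
  have hi : IntervalIntegrable (deriv f) volume a b := by
    refine (intervalIntegrable_const (c := K)).mono_fun
      (measurable_deriv f).aestronglyMeasurable (Eventually.of_forall fun x => ?_)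
    exact (hK x).trans (le_abs_self K)
  exact (integral_eq_of_hasDerivAt_off_countable f (deriv f) hScount hc.continuousOn
    (fun x hx => ((hd x hx.2).differentiableAt one_ne_zero).hasDerivAt) hi).symm

namespace Market

/-- All the scale parameters of the market are positive. -/
structure IsPositive (M : Market) : Prop where
  σθ_pos : 0 < M.σθ
  σε_pos : 0 < M.σε
  p_pos : 0 < M.p

variable {M : Market} (hM : M.IsPositive)

/-! ### Bayes' rule for the normal model. -/

section Parameters

theorem σ_sq : M.σ ^ 2 = M.σε ^ 2 + M.σθ ^ 2 := Real.sq_sqrt (by positivity)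

include hM

theorem σ_pos : 0 < M.σ := Real.sqrt_pos.2 (by have := hM.σε_pos; positivity)

theorem τ_pos : 0 < M.τ := by
  have := hM.σε_pos; have := hM.σθ_pos
  unfold τ; positivity

theorem σv_pos : 0 < M.σv := div_pos (mul_pos hM.σε_pos hM.σθ_pos) (σ_pos hM)

theorem width_pos : 0 < M.τ * M.p := mul_pos (τ_pos hM) hM.p_pos

/-- Both sides are the joint density of quality and valuation at `(v, c)`, factored in the two
possible orders. The proof completes the square in the exponents. -/
theorem density_mul_density (c v : ℝ) :
    phi ((v - M.θ) / M.σθ) / M.σθ * (phi ((v - c) / M.σε) / M.σε) =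
      phi ((M.θ - c) / M.σ) / M.σ * (phi ((v - M.μ c) / M.σv) / M.σv) := by
  have h1 := hM.σε_pos
  have h2 := hM.σθ_pos
  have h3 := σ_pos hM
  have h4 := σ_sq (M := M)
  have h5 : M.σv = M.σε * M.σθ / M.σ := rfl
  have e : -((v - M.θ) / M.σθ) ^ 2 / 2 + -((v - c) / M.σε) ^ 2 / 2 =
      -((M.θ - c) / M.σ) ^ 2 / 2 + -((v - M.μ c) / M.σv) ^ 2 / 2 := by
    have h6 : M.μ c = (M.σθ ^ 2 * c + M.σε ^ 2 * M.θ) / M.σ ^ 2 := by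
      rw [μ, τ, ← h4]
      field_simp
      rw [h4]; ring
    rw [h6, h5]
    field_simp
    rw [h4]
    ring
  have e' := congrArg Real.exp e
  rw [Real.exp_add, Real.exp_add] at e'
  simp only [phi_eq]
  calc _ = (√(2 * Real.pi))⁻¹ * (√(2 * Real.pi))⁻¹ / (M.σε * M.σθ) *
        (Real.exp (-((v - M.θ) / M.σθ) ^ 2 / 2) * Real.exp (-((v - c) / M.σε) ^ 2 / 2)) := by
        field_simp
    _ = _ := by
        rw [e', show M.σε * M.σθ = M.σ * M.σv by rw [h5]; field_simp]
        have := σv_pos hM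
        field_simp

theorem integral_mul_density (c : ℝ) (u : ℝ → ℝ) :
    ∫ v, u v * (phi ((v - c) / M.σε) / M.σε) ∂M.qualityLaw =
      phi ((M.θ - c) / M.σ) / M.σ * ∫ v, u v ∂M.posterior c := by
  rw [qualityLaw, posterior, integral_normalLaw hM.σθ_pos, integral_normalLaw (σv_pos hM),
    ← integral_const_mul]
  congr 1 with v
  have := density_mul_density hM c v
  linear_combination u v * this

end Parameters

instance (x : ℝ) : IsProbabilityMeasure (M.posterior x) := isProbabilityMeasure_normalLaw _ _

instance : IsProbabilityMeasure M.qualityLaw := isProbabilityMeasure_normalLaw _ _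

/-! ### The ramp and its posterior mean. -/

section Ramp

/-- The reward program that is saturated up to `0`, then falls at the maximal rate to `0`. -/
def ramp (M : Market) (t : ℝ) : ℝ := max 0 (min M.p (M.p - 1 / M.τ * t))

theorem ramp_nonneg (t : ℝ) : 0 ≤ M.ramp t := le_max_left _ _

theorem continuous_ramp : Continuous M.ramp := by unfold ramp; fun_prop

/-- Expected value of `ramp` at a normal variable with mean `-a` and standard deviation `σv`. -/
def expectedRamp (M : Market) (a : ℝ) : ℝ := 1 / M.τ * ∫ w in a..a + M.τ * M.p, Phi (w / M.σv)

/-- Probability that the centred posterior lies in `[a, a + τ p]`. -/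
def slopeMass (M : Market) (a : ℝ) : ℝ := Phi ((a + M.τ * M.p) / M.σv) - Phi (a / M.σv)

include hM

theorem ramp_le (t : ℝ) : M.ramp t ≤ M.p := max_le hM.p_pos.le (min_le_left _ _)

theorem abs_ramp_le (t : ℝ) : |M.ramp t| ≤ M.p := by
  rw [abs_of_nonneg (ramp_nonneg t)]; exact ramp_le hM t

theorem ramp_of_nonpos {t : ℝ} (ht : t ≤ 0) : M.ramp t = M.p := by
  have h1 : 1 / M.τ * t ≤ 0 := mul_nonpos_of_nonneg_of_nonpos (by have := τ_pos hM; positivity) ht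
  rw [ramp, min_eq_left (by linarith), max_eq_right hM.p_pos.le]

theorem ramp_of_mem {t : ℝ} (ht : 0 ≤ t) (ht' : t ≤ M.τ * M.p) :
    M.ramp t = M.p - 1 / M.τ * t := by
  have h0 := τ_pos hM
  have h1 : 0 ≤ 1 / M.τ * t := by positivity
  have h2 : 1 / M.τ * t ≤ M.p := by rw [one_div_mul_eq_div, div_le_iff₀ h0]; linarith
  rw [ramp, min_eq_right (by linarith), max_eq_right (by linarith)]

theorem ramp_of_ge {t : ℝ} (ht : M.τ * M.p ≤ t) : M.ramp t = 0 := by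
  have h0 := τ_pos hM
  have h2 : M.p ≤ 1 / M.τ * t := by rw [one_div_mul_eq_div, le_div_iff₀ h0]; linarith
  rw [ramp]
  exact max_eq_left ((min_le_right _ _).trans (by linarith))

theorem saturatedLinear_eq_ramp (b : ℝ) :
    M.saturatedLinear b (b + M.τ * M.p) = fun v => M.ramp (v - b) := by
  ext v
  rw [saturatedLinear]
  split_ifs with h1 h2
  · rw [ramp_of_nonpos hM (by linarith)]
  · rw [ramp_of_mem hM (by linarith) (by linarith)]
  · rw [ramp_of_ge hM (by linarith)]

theorem lipschitzWith_ramp :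
    LipschitzWith (NNReal.mk (1 / M.τ) (one_div_nonneg.2 (τ_pos hM).le)) M.ramp := by
  refine LipschitzWith.const_max (LipschitzWith.const_min ?_ _) _
  refine LipschitzWith.of_dist_le_mul fun x y => ?_
  rw [Real.dist_eq, Real.dist_eq, NNReal.coe_mk, ← abs_of_pos (one_div_pos.2 (τ_pos hM)),
    ← abs_mul, abs_of_pos (one_div_pos.2 (τ_pos hM)), ← abs_neg]
  exact le_of_eq (congrArg _ (by ring))

theorem hasDerivAt_ramp {t : ℝ} (h0 : t ≠ 0) (h1 : t ≠ M.τ * M.p) :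
    HasDerivAt M.ramp (if t ∈ Set.Ioc 0 (M.τ * M.p) then -(1 / M.τ) else 0) t := by
  have hw := width_pos hM
  rcases lt_or_gt_of_ne h0 with h | h
  · rw [if_neg fun H => absurd H.1 (not_lt.2 h.le)]
    refine (hasDerivAt_const t M.p).congr_of_eventuallyEq ?_
    filter_upwards [Iio_mem_nhds h] with s hs using ramp_of_nonpos hM (le_of_lt hs)
  · rcases lt_or_gt_of_ne h1 with h' | h'
    · rw [if_pos ⟨h, h'.le⟩]
      have : HasDerivAt (fun s => M.p - 1 / M.τ * s) (-(1 / M.τ)) t := by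
        simpa using ((hasDerivAt_id t).const_mul (1 / M.τ)).const_sub M.p
      refine this.congr_of_eventuallyEq ?_
      filter_upwards [Ioo_mem_nhds h h'] with s hs using ramp_of_mem hM hs.1.le hs.2.le
    · rw [if_neg fun H => absurd H.2 (not_le.2 h')]
      refine (hasDerivAt_const t 0).congr_of_eventuallyEq ?_
      filter_upwards [Ioi_mem_nhds h'] with s hs using ramp_of_ge hM (le_of_lt hs)

/-- Layer-cake form: the ramp is `1/τ` times the length of the part of its sloped interval lying
above `v`. Fubini then turns its expectation into an integral of the distribution function. -/
theorem ramp_eq_integral (b v : ℝ) :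
    M.ramp (v - b) =
      1 / M.τ * ∫ w in Set.Ioc b (b + M.τ * M.p), (Set.Iic w).indicator (fun _ => (1 : ℝ)) v := by
  have hw := width_pos hM
  have e : ∀ w, (Set.Iic w).indicator (fun _ => (1 : ℝ)) v =
      (Set.Ici v).indicator (fun _ => (1 : ℝ)) w := fun w => by
    simp [Set.indicator_apply]
  simp only [e]
  rw [setIntegral_indicator measurableSet_Ici, setIntegral_const, smul_eq_mul, mul_one]
  have ht := (τ_pos hM).ne'
  by_cases h : v ≤ b
  · have : Set.Ioc b (b + M.τ * M.p) ∩ Set.Ici v = Set.Ioc b (b + M.τ * M.p) := by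
      ext w; simp only [Set.mem_inter_iff, Set.mem_Ioc, Set.mem_Ici]
      constructor
      · exact fun H => H.1
      · exact fun H => ⟨H, h.trans H.1.le⟩
    rw [this, Real.volume_real_Ioc_of_le (by linarith), ramp_of_nonpos hM (by linarith)]
    field_simp; ring
  · push Not at h
    have : Set.Ioc b (b + M.τ * M.p) ∩ Set.Ici v = Set.Icc v (b + M.τ * M.p) := by
      ext w; simp only [Set.mem_inter_iff, Set.mem_Ioc, Set.mem_Ici, Set.mem_Icc]
      constructor
      · exact fun H => ⟨H.2, H.1.2⟩
      · exact fun H => ⟨⟨h.trans_le H.1, H.2⟩, H.1⟩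
    rw [this]
    rcases le_total v (b + M.τ * M.p) with h' | h'
    · rw [Real.volume_real_Icc_of_le h', ramp_of_mem hM (by linarith) (by linarith)]
      field_simp; ring
    · rw [Real.volume_real_Icc, max_eq_right (by linarith), ramp_of_ge hM (by linarith), mul_zero]

theorem integral_ramp (b x : ℝ) :
    ∫ v, M.ramp (v - b) ∂M.posterior x = M.expectedRamp (b - M.μ x) := by
  have hw := width_pos hM
  simp only [ramp_eq_integral hM b]
  rw [integral_const_mul, integral_integral_swap]
  · rw [expectedRamp]
    congr 1
    have e := intervalIntegral.integral_comp_sub_right (a := b) (b := b + M.τ * M.p)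
      (fun w => Phi (w / M.σv)) (M.μ x)
    rw [show b - M.μ x + M.τ * M.p = b + M.τ * M.p - M.μ x by ring, ← e,
      intervalIntegral.integral_of_le (by linarith)]
    congr 1 with w
    rw [integral_indicator measurableSet_Iic, setIntegral_const, smul_eq_mul, mul_one, posterior,
      normalLaw_real_Iic (σv_pos hM)]
  · have e : Function.uncurry (fun v w : ℝ => (Set.Iic w).indicator (fun _ => (1 : ℝ)) v) =
        {q : ℝ × ℝ | q.1 ≤ q.2}.indicator fun _ => 1 := by
      ext q; simp [Function.uncurry, Set.indicator_apply]
    rw [e]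
    exact (integrable_const 1).indicator (measurableSet_le measurable_fst measurable_snd)

theorem expectedRamp_eq (a : ℝ) :
    M.expectedRamp a = M.σv / M.τ *
      ((a + M.τ * M.p) / M.σv * Phi ((a + M.τ * M.p) / M.σv) - a / M.σv * Phi (a / M.σv) +
        phi ((a + M.τ * M.p) / M.σv) - phi (a / M.σv)) := by
  rw [expectedRamp, integral_Phi_div (σv_pos hM)]
  ring

theorem hasDerivAt_expectedRamp (a : ℝ) :
    HasDerivAt M.expectedRamp (1 / M.τ * M.slopeMass a) a := by
  have hs := (σv_pos hM).ne'
  have h1 : HasDerivAt (fun a => a / M.σv) (1 / M.σv) a := (hasDerivAt_id a).div_const _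
  have h2 : HasDerivAt (fun a => (a + M.τ * M.p) / M.σv) (1 / M.σv) a :=
    ((hasDerivAt_id a).add_const _).div_const _
  have h3 := (hasDerivAt_mul_Phi_add_phi _).comp a h1
  have h4 := (hasDerivAt_mul_Phi_add_phi _).comp a h2
  have h5 := (h4.sub h3).const_mul (M.σv / M.τ)
  refine (h5.congr_of_eventuallyEq (Eventually.of_forall fun b => ?_)).congr_deriv ?_
  · rw [expectedRamp_eq hM]
    simp only [Pi.sub_apply, Function.comp_apply]
    ring
  · rw [slopeMass]; field_simp

theorem slopeMass_pos (a : ℝ) : 0 < M.slopeMass a :=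
  sub_pos.2 (strictMono_Phi (by have := σv_pos hM; have := width_pos hM; gcongr; linarith))

omit hM in
theorem slopeMass_lt_one (a : ℝ) : M.slopeMass a < 1 := by
  have := Phi_lt_one ((a + M.τ * M.p) / M.σv)
  have := Phi_pos (a / M.σv)
  rw [slopeMass]; linarith

theorem continuous_expectedRamp : Continuous M.expectedRamp :=
  continuous_iff_continuousAt.2 fun a => (hasDerivAt_expectedRamp hM a).continuousAt

theorem expectedRamp_le (a : ℝ) : M.expectedRamp a ≤ M.p * Phi ((a + M.τ * M.p) / M.σv) := by
  have ht := τ_pos hM; have hs := σv_pos hM; have hw := width_pos hM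
  have : ∫ w in a..a + M.τ * M.p, Phi (w / M.σv) ≤
      ∫ _ in a..a + M.τ * M.p, Phi ((a + M.τ * M.p) / M.σv) := by
    refine intervalIntegral.integral_mono_on (by linarith)
      (Continuous.intervalIntegrable (by have := continuous_Phi; fun_prop) _ _)
      (by simp) fun w hw => strictMono_Phi.monotone ?_
    have := hw.2
    gcongr
  rw [intervalIntegral.integral_const, smul_eq_mul, add_sub_cancel_left] at this
  rw [expectedRamp, one_div_mul_eq_div, div_le_iff₀ ht]
  linarith

theorem le_expectedRamp (a : ℝ) : M.p * Phi (a / M.σv) ≤ M.expectedRamp a := by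
  have ht := τ_pos hM; have hs := σv_pos hM; have hw := width_pos hM
  have : ∫ _ in a..a + M.τ * M.p, Phi (a / M.σv) ≤
      ∫ w in a..a + M.τ * M.p, Phi (w / M.σv) := by
    refine intervalIntegral.integral_mono_on (by linarith) (by simp)
      (Continuous.intervalIntegrable (by have := continuous_Phi; fun_prop) _ _)
      fun w hw => strictMono_Phi.monotone ?_
    have := hw.1
    gcongr
  rw [intervalIntegral.integral_const, smul_eq_mul, add_sub_cancel_left] at this
  rw [expectedRamp, one_div_mul_eq_div, le_div_iff₀ ht]
  linarith

theorem expectedRamp_pos (a : ℝ) : 0 < M.expectedRamp a :=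
  (mul_pos hM.p_pos (Phi_pos _)).trans_le (le_expectedRamp hM a)

theorem expectedRamp_lt (a : ℝ) : M.expectedRamp a < M.p :=
  (expectedRamp_le hM a).trans_lt (by
    have := mul_lt_mul_of_pos_left (Phi_lt_one ((a + M.τ * M.p) / M.σv)) hM.p_pos
    linarith)

theorem tendsto_expectedRamp_atBot : Tendsto M.expectedRamp atBot (𝓝 0) := by
  have h : Tendsto (fun a => M.p * Phi ((a + M.τ * M.p) / M.σv)) atBot (𝓝 (M.p * 0)) :=
    (tendsto_Phi_atBot.comp
      ((tendsto_atBot_add_const_right _ _ tendsto_id).atBot_div_const (σv_pos hM))).const_mul _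
  rw [mul_zero] at h
  exact squeeze_zero (fun a => (expectedRamp_pos hM a).le) (expectedRamp_le hM) h

theorem tendsto_expectedRamp_atTop : Tendsto M.expectedRamp atTop (𝓝 M.p) := by
  have h : Tendsto (fun a => M.p * Phi (a / M.σv)) atTop (𝓝 (M.p * 1)) :=
    (tendsto_Phi_atTop.comp (tendsto_id.atTop_div_const (σv_pos hM))).const_mul _
  rw [mul_one] at h
  exact tendsto_of_tendsto_of_tendsto_of_le_of_le h tendsto_const_nhds (le_expectedRamp hM)
    fun a => (expectedRamp_lt hM a).le

/-- With `y = p - c`, this provides a ramp for every cutoff strictly between `0` and `p`. -/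
theorem exists_expectedRamp_eq {y : ℝ} (h0 : 0 < y) (h1 : y < M.p) :
    ∃ a, M.expectedRamp a = y := by
  obtain ⟨a, ha⟩ := ((tendsto_expectedRamp_atBot hM).eventually (gt_mem_nhds h0)).exists
  obtain ⟨b, hb⟩ := ((tendsto_expectedRamp_atTop hM).eventually (lt_mem_nhds h1)).exists
  exact mem_range_of_exists_le_of_exists_ge (continuous_expectedRamp hM) ⟨a, ha.le⟩ ⟨b, hb.le⟩

end Ramp

/-! ### The one-parameter family of ramps and the derivative of its profit. -/

section RampProgram

/-- Equilibrium cutoff of the ramp that starts at distance `a` from the posterior mean of the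
marginal consumer. -/
def rampCutoff (M : Market) (a : ℝ) : ℝ := M.p - M.expectedRamp a

/-- Starting point of the ramp at distance `a` from the posterior mean of the marginal consumer. -/
def rampStart (M : Market) (a : ℝ) : ℝ := M.μ (M.rampCutoff a) + a

/-- The reward program with a ramp at distance `a` from the posterior mean of the marginal
consumer. -/
def rampProgram (M : Market) (a v : ℝ) : ℝ := M.ramp (v - M.rampStart a)

/-- Expected profit of `rampProgram`. -/
def rampProfit (M : Market) (a : ℝ) : ℝ := M.profit (M.rampProgram a) (M.rampCutoff a)

/-- Expected sales volume on the event that the quality lies on the ramp. -/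
def rampSales (M : Market) (a : ℝ) : ℝ :=
  ∫ w in M.rampStart a..M.rampStart a + M.τ * M.p,
    Phi ((w - M.rampCutoff a) / M.σε) * (phi ((M.θ - w) / M.σθ) / M.σθ)

theorem rampStart_sub_μ (a : ℝ) : M.rampStart a - M.μ (M.rampCutoff a) = a := by
  rw [rampStart]; ring

theorem continuous_salesVolume (c : ℝ) : Continuous (M.salesVolume c) := by
  have := continuous_Phi
  unfold salesVolume; fun_prop

theorem salesVolume_pos (c v : ℝ) : 0 < M.salesVolume c v := Phi_pos _

theorem salesVolume_le_one (c v : ℝ) : M.salesVolume c v ≤ 1 := Phi_le_one _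

include hM

omit hM in
theorem integrable_profit {r : ℝ → ℝ} (hr : Continuous r) (hr' : ∀ v, r v ∈ Set.Icc 0 M.p)
    (c : ℝ) : Integrable (fun v => (M.p - r v) * M.salesVolume c v) M.qualityLaw := by
  refine Integrable.of_bound (C := M.p)
    (((continuous_const.sub hr).mul (continuous_salesVolume c)).aestronglyMeasurable)
    (Eventually.of_forall fun v => ?_)
  have h1 := hr' v
  have h2 := salesVolume_pos (M := M) c v
  have h3 := salesVolume_le_one (M := M) c v
  rw [Real.norm_eq_abs, abs_of_nonneg (mul_nonneg (sub_nonneg.2 h1.2) h2.le)]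
  nlinarith [h1.1, h1.2]

omit hM in
theorem profit_nonneg {r : ℝ → ℝ} (hr' : ∀ v, r v ∈ Set.Icc 0 M.p) (c : ℝ) :
    0 ≤ M.profit r c :=
  integral_nonneg fun v => mul_nonneg (sub_nonneg.2 (hr' v).2) (salesVolume_pos c v).le

theorem rampProgram_mem (a v : ℝ) : M.rampProgram a v ∈ Set.Icc 0 M.p :=
  ⟨ramp_nonneg _, ramp_le hM _⟩

omit hM in
theorem continuous_rampProgram (a : ℝ) : Continuous (M.rampProgram a) := by
  have := continuous_ramp (M := M)
  unfold rampProgram; fun_prop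

theorem saturatedLinear_rampStart (a : ℝ) :
    M.saturatedLinear (M.rampStart a) (M.rampStart a + M.τ * M.p) = M.rampProgram a :=
  saturatedLinear_eq_ramp hM _

theorem integral_rampProgram (a : ℝ) :
    ∫ v, M.rampProgram a v ∂M.posterior (M.rampCutoff a) = M.p - M.rampCutoff a := by
  rw [show M.p - M.rampCutoff a = M.expectedRamp a by rw [rampCutoff]; ring]
  simp only [rampProgram]
  rw [integral_ramp hM, rampStart_sub_μ]

theorem hasDerivAt_rampCutoff (a : ℝ) :
    HasDerivAt M.rampCutoff (-(1 / M.τ * M.slopeMass a)) a :=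
  (hasDerivAt_expectedRamp hM a).const_sub _

theorem hasDerivAt_rampStart (a : ℝ) : HasDerivAt M.rampStart (1 - M.slopeMass a) a := by
  have h := ((((hasDerivAt_rampCutoff hM a).const_mul M.τ).add_const
    ((1 - M.τ) * M.θ)).add (hasDerivAt_id a))
  refine h.congr_deriv ?_
  have := (τ_pos hM).ne'
  field_simp
  ring

theorem lipschitzWith_rampCutoff :
    LipschitzWith (NNReal.mk (1 / M.τ) (one_div_nonneg.2 (τ_pos hM).le)) M.rampCutoff :=
  lipschitzWith_of_nnnorm_deriv_le (fun x => (hasDerivAt_rampCutoff hM x).differentiableAt)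
    fun x => by
      have h1 := slopeMass_pos hM x
      have h2 := slopeMass_lt_one (M := M) x
      have h3 := one_div_pos.2 (τ_pos hM)
      rw [(hasDerivAt_rampCutoff hM x).deriv, ← NNReal.coe_le_coe, coe_nnnorm, norm_neg,
        Real.norm_eq_abs, abs_of_pos (by positivity), NNReal.coe_mk]
      nlinarith

theorem lipschitzWith_rampStart : LipschitzWith 1 M.rampStart :=
  lipschitzWith_of_nnnorm_deriv_le (fun x => (hasDerivAt_rampStart hM x).differentiableAt)
    fun x => by
      have h1 := slopeMass_pos hM x
      have h2 := slopeMass_lt_one (M := M) x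
      rw [(hasDerivAt_rampStart hM x).deriv, ← NNReal.coe_le_coe, coe_nnnorm,
        Real.norm_eq_abs, abs_of_pos (by linarith), NNReal.coe_one]
      linarith

/-- Two effects of raising `a`: the cutoff falls at rate `slopeMass / τ`, which adds buyers, and the
ramp moves right at rate `1 - slopeMass`, which raises rewards on the slope. -/
theorem hasDerivAt_profit_integrand {a v : ℝ} (h0 : v ≠ M.rampStart a)
    (h1 : v ≠ M.rampStart a + M.τ * M.p) :
    HasDerivAt (fun a => (M.p - M.rampProgram a v) * M.salesVolume (M.rampCutoff a) v)
      (M.slopeMass a / M.τ * ((M.p - M.rampProgram a v) *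
          (phi ((v - M.rampCutoff a) / M.σε) / M.σε)) -
        (1 - M.slopeMass a) / M.τ *
          (Set.Ioc (M.rampStart a) (M.rampStart a + M.τ * M.p)).indicator
            (fun v => Phi ((v - M.rampCutoff a) / M.σε)) v) a := by
  have hr : HasDerivAt (fun a => M.rampProgram a v) _ a :=
    (hasDerivAt_ramp hM (t := v - M.rampStart a) (sub_ne_zero.2 h0)
      (fun H => h1 (by linarith))).comp a ((hasDerivAt_rampStart hM a).const_sub v)
  have hs : HasDerivAt (fun a => M.salesVolume (M.rampCutoff a) v) _ a :=
    (hasDerivAt_Phi ((v - M.rampCutoff a) / M.σε)).comp a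
      (((hasDerivAt_rampCutoff hM a).const_sub v).div_const M.σε)
  refine ((hr.const_sub M.p).mul hs).congr_deriv ?_
  have e : v - M.rampStart a ∈ Set.Ioc 0 (M.τ * M.p) ↔
      v ∈ Set.Ioc (M.rampStart a) (M.rampStart a + M.τ * M.p) := by
    simp only [Set.mem_Ioc, sub_pos, sub_le_iff_le_add']
  simp only [e, Set.indicator_apply, salesVolume]
  split_ifs <;> ring

theorem integral_indicator_Phi (a : ℝ) :
    ∫ v, (Set.Ioc (M.rampStart a) (M.rampStart a + M.τ * M.p)).indicator
      (fun v => Phi ((v - M.rampCutoff a) / M.σε)) v ∂M.qualityLaw = M.rampSales a := by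
  have := width_pos hM
  rw [rampSales, intervalIntegral.integral_of_le (by linarith),
    ← integral_indicator measurableSet_Ioc, qualityLaw, integral_normalLaw hM.σθ_pos]
  congr 1 with v
  simp only [Set.indicator_apply, phi_sub_comm_div M.θ v]
  split_ifs <;> ring

/-- Differentiation under the integral. By Bayes' rule the effect of new buyers is the valuation
density at the cutoff times the posterior mean of `p - r`, which indifference makes equal to the
cutoff. -/
theorem hasDerivAt_rampProfit (a : ℝ) :
    HasDerivAt M.rampProfit (1 / M.τ *
      (M.slopeMass a * (M.rampCutoff a * (phi ((M.θ - M.rampCutoff a) / M.σ) / M.σ)) -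
        (1 - M.slopeMass a) * M.rampSales a)) a := by
  have hτ := τ_pos hM
  have hε := hM.σε_pos
  have cΦ := continuous_Phi
  have cφ := continuous_phi
  have cr := continuous_rampProgram (M := M) a
  have := nullSingletonClass_normalLaw hM.σθ_pos M.θ
  set F' : ℝ → ℝ := fun v => M.slopeMass a / M.τ * ((M.p - M.rampProgram a v) *
          (phi ((v - M.rampCutoff a) / M.σε) / M.σε)) -
        (1 - M.slopeMass a) / M.τ *
          (Set.Ioc (M.rampStart a) (M.rampStart a + M.τ * M.p)).indicator
            (fun v => Phi ((v - M.rampCutoff a) / M.σε)) v with hF'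
  have i1 : Integrable (fun v => (M.p - M.rampProgram a v) *
      (phi ((v - M.rampCutoff a) / M.σε) / M.σε)) M.qualityLaw := by
    refine Integrable.of_bound (C := M.p * (phi 0 / M.σε))
      (Continuous.aestronglyMeasurable (by fun_prop)) (Eventually.of_forall fun v => ?_)
    have h1 := rampProgram_mem hM a v
    have h2 := phi_pos ((v - M.rampCutoff a) / M.σε)
    have h4 : 0 ≤ M.p - M.rampProgram a v := sub_nonneg.2 h1.2
    rw [Real.norm_eq_abs, abs_of_nonneg (by positivity)]
    have := hM.p_pos
    gcongr
    · linarith [h1.1]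
    · exact phi_le_phi_zero _
  have i2 : Integrable ((Set.Ioc (M.rampStart a) (M.rampStart a + M.τ * M.p)).indicator
      (fun v => Phi ((v - M.rampCutoff a) / M.σε))) M.qualityLaw := by
    refine Integrable.indicator ?_ measurableSet_Ioc
    refine Integrable.of_bound (C := 1)
      (Continuous.aestronglyMeasurable (by fun_prop)) (Eventually.of_forall fun v => ?_)
    rw [Real.norm_eq_abs, abs_of_pos (Phi_pos _)]
    exact Phi_le_one _
  have key := hasDerivAt_integral_of_dominated_loc_of_lip (μ := M.qualityLaw)
    (F := fun a v => (M.p - M.rampProgram a v) * M.salesVolume (M.rampCutoff a) v)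
    (F' := F') (x₀ := a) (s := Set.univ)
    -- A Lipschitz constant in `a` uniform in `v`: the reward varies at rate at most `1/τ` with
    -- sales at most `1`, and the margin is at most `p` with sales varying at rate at most `phi 0 /
    -- σε * (1/τ)`.
    (bound := fun _ => 1 / M.τ + M.p * (phi 0 / M.σε * (1 / M.τ))) univ_mem
    (Eventually.of_forall fun b =>
      (integrable_profit (continuous_rampProgram b) (rampProgram_mem hM b) _).1)
    (integrable_profit (continuous_rampProgram a) (rampProgram_mem hM a) _)
    ((i1.const_mul _).sub (i2.const_mul _)).1
    (Eventually.of_forall fun v => ?_) (integrable_const _) ?_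
  · refine key.2.congr_deriv ?_
    rw [integral_sub (i1.const_mul _) (i2.const_mul _), integral_const_mul, integral_const_mul,
      integral_indicator_Phi hM, integral_mul_density hM, integral_sub (integrable_const _),
      integral_rampProgram hM, integral_const, probReal_univ, one_smul]
    · ring
    · refine Integrable.of_bound (C := M.p) cr.aestronglyMeasurable
        (Eventually.of_forall fun v => abs_ramp_le hM _)
  · refine LipschitzOnWith.of_dist_le_mul fun x _ y _ => ?_
    have hp := hM.p_pos
    have hφ := phi_pos 0
    rw [Real.coe_nnabs, abs_of_pos (by positivity), Real.dist_eq, Real.dist_eq]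
    have l1 : |M.rampProgram x v - M.rampProgram y v| ≤ 1 / M.τ * |x - y| := by
      have e1 := (lipschitzWith_ramp hM).dist_le_mul (v - M.rampStart x) (v - M.rampStart y)
      have e2 := (lipschitzWith_rampStart hM).dist_le_mul x y
      rw [Real.dist_eq, Real.dist_eq, NNReal.coe_mk] at e1
      rw [Real.dist_eq, Real.dist_eq, NNReal.coe_one, one_mul] at e2
      rw [show v - M.rampStart x - (v - M.rampStart y) = -(M.rampStart x - M.rampStart y) by ring,
        abs_neg] at e1
      exact e1.trans (by gcongr)
    have l2 : |M.salesVolume (M.rampCutoff x) v - M.salesVolume (M.rampCutoff y) v| ≤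
        phi 0 / M.σε * (1 / M.τ) * |x - y| := by
      have e1 := lipschitzWith_Phi.dist_le_mul ((v - M.rampCutoff x) / M.σε)
        ((v - M.rampCutoff y) / M.σε)
      have e2 := (lipschitzWith_rampCutoff hM).dist_le_mul x y
      rw [Real.dist_eq, Real.dist_eq, NNReal.coe_mk] at e1 e2
      rw [show (v - M.rampCutoff x) / M.σε - (v - M.rampCutoff y) / M.σε =
        -(M.rampCutoff x - M.rampCutoff y) / M.σε by ring, abs_div, abs_neg, abs_of_pos hε] at e1
      refine e1.trans ?_
      calc _ ≤ phi 0 * (1 / M.τ * |x - y| / M.σε) := by gcongr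
        _ = _ := by ring
    have h1 := rampProgram_mem hM x v
    have h2 := salesVolume_pos (M := M) (M.rampCutoff y) v
    have h3 := salesVolume_le_one (M := M) (M.rampCutoff y) v
    calc _ = |(M.p - M.rampProgram x v) *
            (M.salesVolume (M.rampCutoff x) v - M.salesVolume (M.rampCutoff y) v) +
          -(M.rampProgram x v - M.rampProgram y v) * M.salesVolume (M.rampCutoff y) v| := by
          congr 1; ring
      _ ≤ M.p * (phi 0 / M.σε * (1 / M.τ) * |x - y|) + 1 / M.τ * |x - y| * 1 := by
          refine (abs_add_le _ _).trans ?_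
          rw [abs_mul, abs_mul, abs_neg, abs_of_pos h2,
            abs_of_nonneg (sub_nonneg.2 h1.2)]
          gcongr
          linarith [h1.1]
      _ = _ := by ring
  -- The integrand is differentiated only off the two kinks, which the quality law does not charge.
  · have n1 : ∀ᵐ v ∂M.qualityLaw, v ≠ M.rampStart a := by
      rw [ae_iff]; simp [qualityLaw]
    have n2 : ∀ᵐ v ∂M.qualityLaw, v ≠ M.rampStart a + M.τ * M.p := by
      rw [ae_iff]; simp [qualityLaw]
    filter_upwards [n1, n2] with v h0 h1 using hasDerivAt_profit_integrand hM h0 h1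

end RampProgram

/-! ### Feasibility of the ramps. -/

section Feasibility

include hM

theorem contDiffAt_ramp {t : ℝ} (h0 : t ≠ 0) (h1 : t ≠ M.τ * M.p) : ContDiffAt ℝ 1 M.ramp t := by
  rcases lt_or_gt_of_ne h0 with h | h
  · refine (contDiffAt_const (c := M.p)).congr_of_eventuallyEq ?_
    filter_upwards [Iio_mem_nhds h] with s hs using ramp_of_nonpos hM (le_of_lt hs)
  · rcases lt_or_gt_of_ne h1 with h' | h'
    · refine ContDiffAt.congr_of_eventuallyEq (f := fun s => M.p - 1 / M.τ * s) (by fun_prop) ?_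
      filter_upwards [Ioo_mem_nhds h h'] with s hs using ramp_of_mem hM hs.1.le hs.2.le
    · refine (contDiffAt_const (c := 0)).congr_of_eventuallyEq ?_
      filter_upwards [Ioi_mem_nhds h'] with s hs using ramp_of_ge hM (le_of_lt hs)

theorem deriv_rampProgram {a v : ℝ} (h0 : v ≠ M.rampStart a)
    (h1 : v ≠ M.rampStart a + M.τ * M.p) :
    deriv (M.rampProgram a) v =
      if v - M.rampStart a ∈ Set.Ioc 0 (M.τ * M.p) then -(1 / M.τ) else 0 := by
  have := (hasDerivAt_ramp hM (t := v - M.rampStart a) (sub_ne_zero.2 h0)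
      (fun H => h1 (by linarith))).comp_sub_const v (M.rampStart a)
  exact this.deriv

theorem isPiecewiseC1_rampProgram (a : ℝ) : IsPiecewiseC1 (M.rampProgram a) := by
  have hw := width_pos hM
  have key : ∀ {F : Filter ℝ} {T : Set ℝ} {l : ℝ}, T ∈ F →
      (∀ v ∈ T, deriv (M.rampProgram a) v = l) → ∃ l, Tendsto (deriv (M.rampProgram a)) F (𝓝 l) :=
    fun {F T l} hT h => ⟨l, tendsto_const_nhds.congr' (by
      filter_upwards [hT] with v hv using (h v hv).symm)⟩
  refine ⟨continuous_rampProgram a, {M.rampStart a, M.rampStart a + M.τ * M.p},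
    fun _ _ => (Set.toFinite _).inter_of_left _, fun x hx => ?_, ?_⟩
  · simp only [Set.mem_insert_iff, Set.mem_singleton_iff, not_or] at hx
    exact (contDiffAt_ramp hM (t := x - M.rampStart a) (sub_ne_zero.2 hx.1)
      (fun H => hx.2 (by linarith))).comp x (contDiffAt_id.sub contDiffAt_const)
  · rintro x (rfl | rfl)
    · refine ⟨key self_mem_nhdsWithin (l := 0) fun v hv => ?_,
        key (Ioo_mem_nhdsGT (lt_add_of_pos_right (M.rampStart a) hw))
          (l := -(1 / M.τ)) fun v hv => ?_⟩
      · have hv' : v < M.rampStart a := hv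
        rw [deriv_rampProgram hM (by linarith) (by linarith), if_neg]
        exact fun H => by linarith [H.1]
      · rw [deriv_rampProgram hM hv.1.ne' hv.2.ne, if_pos]
        exact ⟨by linarith [hv.1], by linarith [hv.2]⟩
    · refine ⟨key (Ioo_mem_nhdsLT (lt_add_of_pos_right (M.rampStart a) hw))
          (l := -(1 / M.τ)) fun v hv => ?_, key self_mem_nhdsWithin (l := 0) fun v hv => ?_⟩
      · rw [deriv_rampProgram hM hv.1.ne' hv.2.ne, if_pos]
        exact ⟨by linarith [hv.1], by linarith [hv.2]⟩
      · have hv' : M.rampStart a + M.τ * M.p < v := hv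
        rw [deriv_rampProgram hM (by linarith) (by linarith), if_neg]
        exact fun H => by linarith [H.2]

theorem isRateConstrained_rampProgram (a : ℝ) : M.IsRateConstrained (M.rampProgram a) where
  mem_range := rampProgram_mem hM a
  piecewiseC1 := isPiecewiseC1_rampProgram hM a
  rate v _ := by
    have h := norm_deriv_le_of_lipschitz (x₀ := v - M.rampStart a) (lipschitzWith_ramp hM)
    rwa [← deriv_comp_sub_const] at h

/-- The posterior mean moves at rate `τ` in `x` and the reward falls at rate `1/τ` only on the
slope, so the payoff has derivative `1 - slopeMass > 0`; its zero is the cutoff. -/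
theorem isEquilibriumCutoff_rampProgram (a : ℝ) :
    M.IsEquilibriumCutoff (M.rampProgram a) (M.rampCutoff a) := by
  have e : ∀ x, M.payoff (M.rampProgram a) x =
      x - M.p + M.expectedRamp (M.rampStart a - M.μ x) := fun x => by
    rw [payoff, ← integral_ramp hM]
    rfl
  have hmono : StrictMono fun x => x - M.p + M.expectedRamp (M.rampStart a - M.μ x) :=
    strictMono_of_deriv_pos fun x => by
      have h1 : HasDerivAt M.μ M.τ x := by
        exact (((hasDerivAt_id x).const_mul M.τ).add_const ((1 - M.τ) * M.θ)).congr_deriv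
          (mul_one _)
      have h2 := ((hasDerivAt_id x).sub_const M.p).add
        ((hasDerivAt_expectedRamp hM _).comp x (h1.const_sub (M.rampStart a)))
      have h3 := slopeMass_lt_one (M := M) (M.rampStart a - M.μ x)
      have h4 : deriv (fun x => x - M.p + M.expectedRamp (M.rampStart a - M.μ x)) x = _ := h2.deriv
      rw [h4]
      have := (τ_pos hM).ne'
      field_simp
      linarith
  have h0 : M.rampCutoff a - M.p + M.expectedRamp (M.rampStart a - M.μ (M.rampCutoff a)) = 0 := by
    rw [rampStart_sub_μ, rampCutoff]; ring
  intro x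
  rw [e, ← h0]
  exact hmono.lt_iff_lt

theorem isFeasible_rampProgram (a : ℝ) : M.IsFeasible (M.rampProgram a) (M.rampCutoff a) :=
  ⟨isRateConstrained_rampProgram hM a, isEquilibriumCutoff_rampProgram hM a⟩

end Feasibility

/-! ### Existence of a best ramp. -/

section Maximum

include hM

theorem rampSales_integrand_eq (c w : ℝ) :
    Phi ((w - c) / M.σε) * (phi ((M.θ - w) / M.σθ) / M.σθ) =
      Phi ((w - c) / M.σε) / phi ((w - c) / M.σε) *
        (M.σε * (phi ((M.θ - c) / M.σ) / M.σ) * (phi ((w - M.μ c) / M.σv) / M.σv)) := by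
  have h1 := density_mul_density hM c w
  have h2 := phi_pos ((w - c) / M.σε)
  have h3 := hM.σε_pos
  rw [mul_assoc M.σε, ← h1, phi_sub_comm_div M.θ w]
  field_simp

theorem integral_posterior_density (a : ℝ) :
    ∫ w in M.rampStart a..M.rampStart a + M.τ * M.p,
      phi ((w - M.μ (M.rampCutoff a)) / M.σv) / M.σv = M.slopeMass a := by
  have hs := σv_pos hM
  have h : ∀ w, HasDerivAt (fun w => Phi ((w - M.μ (M.rampCutoff a)) / M.σv))
      (phi ((w - M.μ (M.rampCutoff a)) / M.σv) / M.σv) w := fun w => by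
    refine ((hasDerivAt_Phi _).comp w
      (((hasDerivAt_id w).sub_const (M.μ (M.rampCutoff a))).div_const M.σv)).congr_deriv ?_
    simp only [id_eq]
    ring
  rw [intervalIntegral.integral_eq_sub_of_hasDerivAt (fun w _ => h w)
    (Continuous.intervalIntegrable (by have := continuous_phi; fun_prop) _ _), slopeMass]
  congr 3
  · rw [rampStart]; ring
  · rw [rampStart]; ring

/-- Bayes' rule writes the integrand as `Phi / phi` times a multiple of the posterior density; the
increasing ratio is bounded by its values at the ends of the slope. -/
theorem rampSales_bounds (a : ℝ) :
    Phi ((M.rampStart a - M.rampCutoff a) / M.σε) / phi ((M.rampStart a - M.rampCutoff a) / M.σε) *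
        (M.σε * (phi ((M.θ - M.rampCutoff a) / M.σ) / M.σ) * M.slopeMass a) ≤ M.rampSales a ∧
    M.rampSales a ≤ Phi ((M.rampStart a + M.τ * M.p - M.rampCutoff a) / M.σε) /
        phi ((M.rampStart a + M.τ * M.p - M.rampCutoff a) / M.σε) *
        (M.σε * (phi ((M.θ - M.rampCutoff a) / M.σ) / M.σ) * M.slopeMass a) := by
  have hε := hM.σε_pos
  have hw := width_pos hM
  have cΦ := continuous_Phi
  have cφ := continuous_phi
  have hφ : ∀ x, phi x ≠ 0 := fun x => (phi_pos x).ne'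
  have hf : 0 < phi ((M.θ - M.rampCutoff a) / M.σ) / M.σ := div_pos (phi_pos _) (σ_pos hM)
  have hg : ∀ w, 0 < phi ((w - M.μ (M.rampCutoff a)) / M.σv) / M.σv :=
    fun w => div_pos (phi_pos _) (σv_pos hM)
  rw [rampSales, ← integral_posterior_density hM, ← intervalIntegral.integral_const_mul,
    ← intervalIntegral.integral_const_mul, ← intervalIntegral.integral_const_mul]
  simp only [rampSales_integrand_eq hM]
  constructor <;>
  refine intervalIntegral.integral_mono_on (by linarith)
    (Continuous.intervalIntegrable (by fun_prop (disch := simp [hφ])) _ _)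
    (Continuous.intervalIntegrable (by fun_prop (disch := simp [hφ])) _ _) fun w hw => ?_
  · have := hg w
    refine mul_le_mul_of_nonneg_right (strictMono_Phi_div_phi.monotone ?_) (by positivity)
    have := hw.1
    gcongr
  · have := hg w
    refine mul_le_mul_of_nonneg_right (strictMono_Phi_div_phi.monotone ?_) (by positivity)
    have := hw.2
    gcongr

theorem tendsto_rampCutoff_atBot : Tendsto M.rampCutoff atBot (𝓝 M.p) := by
  have h := (tendsto_expectedRamp_atBot hM).const_sub M.p
  rwa [sub_zero] at h

theorem tendsto_rampCutoff_atTop : Tendsto M.rampCutoff atTop (𝓝 0) := by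
  have h := (tendsto_expectedRamp_atTop hM).const_sub M.p
  rwa [sub_self] at h

omit hM in
theorem continuous_μ : Continuous M.μ := by unfold μ; fun_prop

theorem tendsto_rampStart_atBot : Tendsto M.rampStart atBot atBot :=
  ((continuous_μ.tendsto _).comp (tendsto_rampCutoff_atBot hM)).add_atBot tendsto_id

theorem tendsto_rampStart_atTop : Tendsto M.rampStart atTop atTop :=
  ((continuous_μ.tendsto _).comp (tendsto_rampCutoff_atTop hM)).add_atTop tendsto_id

/-- As `a → -∞` the cutoff tends to `p` while `Phi / phi` on the slope tends to `0`, so the gain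
from new buyers dominates. -/
theorem eventually_deriv_rampProfit_pos : ∀ᶠ a in atBot, 0 < deriv M.rampProfit a := by
  have hε := hM.σε_pos
  have hp := hM.p_pos
  have h1 : ∀ᶠ a in atBot, M.p / 2 < M.rampCutoff a :=
    (tendsto_rampCutoff_atBot hM).eventually (lt_mem_nhds (by linarith))
  have h2 : Tendsto (fun a => (M.rampStart a + M.τ * M.p - M.rampCutoff a) / M.σε) atBot atBot := by
    refine Tendsto.atBot_div_const hε ?_
    have := ((tendsto_rampCutoff_atBot hM).const_sub (M.τ * M.p)).add_atBot
      (tendsto_rampStart_atBot hM)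
    exact this.congr fun a => by ring
  -- The threshold at which `Phi_div_phi_lt` gives `Phi / phi < p / (2 σε)`, matching the lower
  -- bound `p / 2` on the cutoff.
  have h3 := h2.eventually (eventually_lt_atBot (-(2 * M.σε / M.p)))
  filter_upwards [h1, h3] with a h1 h3
  set z := (M.rampStart a + M.τ * M.p - M.rampCutoff a) / M.σε with hz
  have hf : 0 < phi ((M.θ - M.rampCutoff a) / M.σ) / M.σ := div_pos (phi_pos _) (σ_pos hM)
  have hP := slopeMass_pos hM a
  have hP1 := slopeMass_lt_one (M := M) a
  have hb := (rampSales_bounds hM a).2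
  rw [← hz] at hb
  have hz0 : 0 < 2 * M.σε / M.p := by positivity
  have hQ : Phi z / phi z < M.p / (2 * M.σε) := by
    refine (Phi_div_phi_lt (by linarith)).trans ?_
    rw [← inv_div (2 * M.σε)]
    exact inv_strictAnti₀ hz0 (by linarith)
  have hS : M.rampSales a < M.p / 2 * (phi ((M.θ - M.rampCutoff a) / M.σ) / M.σ * M.slopeMass a) := by
    refine hb.trans_lt ?_
    calc _ < M.p / (2 * M.σε) *
          (M.σε * (phi ((M.θ - M.rampCutoff a) / M.σ) / M.σ) * M.slopeMass a) := by gcongr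
      _ = _ := by field_simp
  have hS0 : 0 ≤ M.rampSales a :=
    (rampSales_bounds hM a).1.trans' (by
      have := Phi_pos ((M.rampStart a - M.rampCutoff a) / M.σε)
      have := phi_pos ((M.rampStart a - M.rampCutoff a) / M.σε)
      positivity)
  rw [(hasDerivAt_rampProfit hM a).deriv]
  refine mul_pos (one_div_pos.2 (τ_pos hM)) (sub_pos.2 ?_)
  calc _ ≤ M.rampSales a := by nlinarith
    _ < _ := hS
    _ ≤ M.rampCutoff a * (phi ((M.θ - M.rampCutoff a) / M.σ) / M.σ * M.slopeMass a) := by gcongr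
    _ = _ := by ring

/-- As `a → +∞` the cutoff tends to `0`, while `Phi / phi` on the slope stays at least `Phi 0 / phi
0` and `1 - slopeMass` at least `1/2`. -/
theorem eventually_deriv_rampProfit_neg : ∀ᶠ a in atTop, deriv M.rampProfit a < 0 := by
  have hε := hM.σε_pos
  have hp := hM.p_pos
  have hq : 0 < Phi 0 / phi 0 := div_pos (Phi_pos 0) (phi_pos 0)
  have h1 : ∀ᶠ a in atTop, M.rampCutoff a < M.σε * (Phi 0 / phi 0) / 2 :=
    (tendsto_rampCutoff_atTop hM).eventually (gt_mem_nhds (by positivity))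
  have h2 : Tendsto (fun a => (M.rampStart a - M.rampCutoff a) / M.σε) atTop atTop := by
    refine Tendsto.atTop_div_const hε ?_
    exact ((tendsto_rampCutoff_atTop hM).neg.add_atTop
      (tendsto_rampStart_atTop hM)).congr fun a => by ring
  have h3 := h2.eventually (eventually_ge_atTop 0)
  have h4 : ∀ᶠ a in atTop, 1 / 2 < Phi (a / M.σv) :=
    (tendsto_Phi_atTop.comp (tendsto_id.atTop_div_const (σv_pos hM))).eventually
      (lt_mem_nhds (by norm_num))
  filter_upwards [h1, h3, h4] with a h1 h3 h4
  set z := (M.rampStart a - M.rampCutoff a) / M.σε with hz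
  have hf : 0 < phi ((M.θ - M.rampCutoff a) / M.σ) / M.σ := div_pos (phi_pos _) (σ_pos hM)
  have hP := slopeMass_pos hM a
  have hP1 : M.slopeMass a ≤ 1 / 2 := by
    have := Phi_le_one ((a + M.τ * M.p) / M.σv)
    rw [slopeMass]; linarith
  have hb := (rampSales_bounds hM a).1
  rw [← hz] at hb
  have hQ : Phi 0 / phi 0 ≤ Phi z / phi z := strictMono_Phi_div_phi.monotone h3
  have hS : Phi 0 / phi 0 * (M.σε * (phi ((M.θ - M.rampCutoff a) / M.σ) / M.σ) * M.slopeMass a) ≤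
      M.rampSales a := hb.trans' (by gcongr)
  have hS0 : 0 ≤ M.rampSales a := hS.trans' (by positivity)
  rw [(hasDerivAt_rampProfit hM a).deriv]
  refine mul_neg_of_pos_of_neg (one_div_pos.2 (τ_pos hM)) (sub_neg.2 ?_)
  calc _ = M.rampCutoff a * (phi ((M.θ - M.rampCutoff a) / M.σ) / M.σ * M.slopeMass a) := by ring
    _ < M.σε * (Phi 0 / phi 0) / 2 *
        (phi ((M.θ - M.rampCutoff a) / M.σ) / M.σ * M.slopeMass a) := by gcongr
    _ = 1 / 2 * (Phi 0 / phi 0 *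
        (M.σε * (phi ((M.θ - M.rampCutoff a) / M.σ) / M.σ) * M.slopeMass a)) := by ring
    _ ≤ 1 / 2 * M.rampSales a := by gcongr
    _ ≤ _ := by gcongr; linarith

theorem continuous_rampProfit : Continuous M.rampProfit :=
  continuous_iff_continuousAt.2 fun a => (hasDerivAt_rampProfit hM a).continuousAt

theorem tendsto_rampProfit_atBot :
    Tendsto M.rampProfit atBot (𝓝 (M.profit (fun _ => 0) M.p)) := by
  refine tendsto_integral_filter_of_dominated_convergence (fun _ => M.p)
    (Eventually.of_forall fun a =>
      (integrable_profit (continuous_rampProgram a) (rampProgram_mem hM a) _).1)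
    (Eventually.of_forall fun a => Eventually.of_forall fun v => ?_) (integrable_const _)
    (Eventually.of_forall fun v => ?_)
  · have h1 := rampProgram_mem hM a v
    have h2 := salesVolume_pos (M := M) (M.rampCutoff a) v
    have h3 := salesVolume_le_one (M := M) (M.rampCutoff a) v
    rw [Real.norm_eq_abs, abs_of_nonneg (mul_nonneg (sub_nonneg.2 h1.2) h2.le)]
    nlinarith [h1.1, h1.2]
  · have h0 : Tendsto (fun a => M.rampProgram a v) atBot (𝓝 0) := by
      refine tendsto_const_nhds.congr' ?_
      filter_upwards [(tendsto_rampStart_atBot hM).eventually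
        (eventually_le_atBot (v - M.τ * M.p))] with a ha
      exact (ramp_of_ge hM (by linarith)).symm
    have h1 : Tendsto (fun a => M.salesVolume (M.rampCutoff a) v) atBot
        (𝓝 (M.salesVolume M.p v)) := by
      have : Continuous fun c => M.salesVolume c v := by
        have := continuous_Phi
        unfold salesVolume; fun_prop
      exact (this.tendsto _).comp (tendsto_rampCutoff_atBot hM)
    exact (h0.const_sub M.p).mul h1

/-- A maximum over a compact interval is global by monotonicity of the tails. Their strictness puts
it above the limit at `-∞`, the no-reward profit, and above a nonnegative value on the right. -/
theorem exists_rampProfit_max :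
    ∃ a₀, (∀ a, M.rampProfit a ≤ M.rampProfit a₀) ∧ 0 < M.rampProfit a₀ ∧
      M.profit (fun _ => 0) M.p < M.rampProfit a₀ := by
  obtain ⟨A, hA⟩ := eventually_atBot.1 (eventually_deriv_rampProfit_pos hM)
  obtain ⟨B, hB⟩ := eventually_atTop.1 (eventually_deriv_rampProfit_neg hM)
  have hc := continuous_rampProfit hM
  have monoA : StrictMonoOn M.rampProfit (Set.Iic A) :=
    strictMonoOn_of_deriv_pos (convex_Iic A) hc.continuousOn fun a ha =>
      hA a (Set.mem_Iic.1 (interior_subset ha))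
  have antiB : StrictAntiOn M.rampProfit (Set.Ici B) :=
    strictAntiOn_of_deriv_neg (convex_Ici B) hc.continuousOn fun a ha =>
      hB a (Set.mem_Ici.1 (interior_subset ha))
  obtain ⟨a₀, -, h₀⟩ := (isCompact_Icc (a := A) (b := max A B)).exists_isMaxOn
    ⟨A, le_rfl, le_max_left _ _⟩ hc.continuousOn
  have hA₀ : M.rampProfit A ≤ M.rampProfit a₀ := h₀ ⟨le_rfl, le_max_left _ _⟩
  have hB₀ : M.rampProfit (max A B) ≤ M.rampProfit a₀ := h₀ ⟨le_max_left _ _, le_rfl⟩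
  have hBm : max A B ∈ Set.Ici B := le_max_right A B
  refine ⟨a₀, fun a => ?_, ?_, ?_⟩
  · rcases le_total a A with h | h
    · exact (monoA.monotoneOn h Set.self_mem_Iic h).trans hA₀
    · rcases le_total a (max A B) with h' | h'
      · exact h₀ ⟨h, h'⟩
      · exact (antiB.antitoneOn hBm ((Set.mem_Ici.1 hBm).trans h') h').trans hB₀
  · have h1 : M.rampProfit (max A B + 1) < M.rampProfit (max A B) :=
      antiB hBm (Set.mem_Ici.2 (by linarith [Set.mem_Ici.1 hBm])) (lt_add_one _)
    have h2 : 0 ≤ M.rampProfit (max A B + 1) := profit_nonneg (rampProgram_mem hM _) _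
    linarith
  · have h1 : M.rampProfit (A - 1) < M.rampProfit A :=
      monoA (Set.mem_Iic.2 (by linarith)) Set.self_mem_Iic (sub_one_lt A)
    have h2 : M.profit (fun _ => 0) M.p ≤ M.rampProfit (A - 1) :=
      le_of_tendsto (tendsto_rampProfit_atBot hM) (by
        filter_upwards [eventually_le_atBot (A - 1)] with a ha
        exact monoA.monotoneOn (Set.mem_Iic.2 (by linarith)) (Set.mem_Iic.2 (by linarith)) ha)
    linarith

end Maximum

/-! ### Comparison of a feasible program with the ramp of the same cutoff. -/

section Comparison

include hM

theorem IsRateConstrained.sub_le {r : ℝ → ℝ} (hr : M.IsRateConstrained r) {x y : ℝ}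
    (hxy : x ≤ y) : r x - r y ≤ 1 / M.τ * (y - x) := by
  have hτ := one_div_pos.2 (τ_pos hM)
  have hK : ∀ v, |deriv r v| ≤ 1 / M.τ := fun v => by
    by_cases h : DifferentiableAt ℝ r v
    · exact hr.rate v h
    -- At break points `deriv` takes the default value `0`, so the rate bound holds everywhere.
    · rw [deriv_zero_of_not_differentiableAt h, abs_zero]; exact hτ.le
  have h1 := hr.piecewiseC1.sub_eq_integral_deriv hK x y
  have h2 := intervalIntegral.norm_integral_le_of_norm_le_const (a := x) (b := y)
    (f := deriv r) (C := 1 / M.τ) fun v _ => hK v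
  rw [← h1, Real.norm_eq_abs, abs_of_nonneg (sub_nonneg.2 hxy)] at h2
  linarith [neg_abs_le (r y - r x)]

omit hM in
theorem continuous_payoff {r : ℝ → ℝ} (hc : Continuous r) (hr : ∀ v, r v ∈ Set.Icc 0 M.p) :
    Continuous (M.payoff r) := by
  -- Moves the dependence on `x` from the measure to the integrand, for dominated convergence.
  have e : ∀ x, ∫ v, r v ∂M.posterior x = ∫ z, r (M.μ x + M.σv * z) ∂gaussianReal 0 1 := fun x => by
    rw [posterior, normalLaw_eq_map,
      integral_map (by fun_prop) hc.aestronglyMeasurable]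
  have h : Continuous fun x => ∫ z, r (M.μ x + M.σv * z) ∂gaussianReal 0 1 := by
    have hμ := continuous_μ (M := M)
    refine continuous_of_dominated (bound := fun _ => M.p)
      (fun x => Continuous.aestronglyMeasurable (by fun_prop))
      (fun x => Eventually.of_forall fun z => ?_) (integrable_const _)
      (Eventually.of_forall fun z => by fun_prop)
    rw [Real.norm_eq_abs, abs_of_nonneg (hr _).1]
    exact (hr _).2
  unfold payoff
  simp only [e]
  fun_prop

omit hM in
-- The payoff is positive to the right of `c` and not positive at `c`, so by continuity it vanishes
-- there.
theorem IsFeasible.integral_posterior {r : ℝ → ℝ} {c : ℝ} (h : M.IsFeasible r c) :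
    ∫ v, r v ∂M.posterior c = M.p - c := by
  have hc := continuous_payoff h.1.piecewiseC1.1 h.1.mem_range
  have h1 : M.payoff r c ≤ 0 := not_lt.1 fun H => lt_irrefl _ ((h.2 c).1 H)
  have h2 : 0 ≤ M.payoff r c :=
    ge_of_tendsto ((hc.tendsto c).mono_left (nhdsWithin_le_nhds (s := Set.Ioi c))) (by
      filter_upwards [self_mem_nhdsWithin] with x hx using ((h.2 x).2 hx).le)
  have h3 : M.payoff r c = 0 := le_antisymm h1 h2
  rw [payoff] at h3
  linarith

omit hM in
theorem integrable_of_mem_Icc {μ : Measure ℝ} [IsFiniteMeasure μ] {r : ℝ → ℝ} {p : ℝ}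
    (hc : Continuous r) (hr : ∀ v, r v ∈ Set.Icc 0 p) : Integrable r μ :=
  Integrable.of_bound (C := p) hc.aestronglyMeasurable (Eventually.of_forall fun v => by
    rw [Real.norm_eq_abs, abs_of_nonneg (hr v).1]; exact (hr v).2)

omit hM in
theorem IsFeasible.cutoff_mem {r : ℝ → ℝ} {c : ℝ} (h : M.IsFeasible r c) :
    c ∈ Set.Icc 0 M.p := by
  have h0 := h.integral_posterior
  have h1 : 0 ≤ ∫ v, r v ∂M.posterior c := integral_nonneg fun v => (h.1.mem_range v).1
  have h2 : ∫ v, r v ∂M.posterior c ≤ ∫ _, M.p ∂M.posterior c :=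
    integral_mono (integrable_of_mem_Icc h.1.piecewiseC1.1 h.1.mem_range) (integrable_const _)
      fun v => (h.1.mem_range v).2
  rw [integral_const, probReal_univ, one_smul] at h2
  constructor <;> linarith

omit hM in
theorem eq_zero_of_integral_normalLaw {m s : ℝ} (hs : 0 < s) {u : ℝ → ℝ} (hu : Continuous u)
    (hi : Integrable u (normalLaw m s)) (h0 : ∀ v, 0 ≤ u v) (h : ∫ v, u v ∂normalLaw m s = 0) :
    u = 0 := by
  have := isOpenPosMeasure_normalLaw hs m
  exact (hu.ae_eq_iff_eq _ continuous_zero).1 ((integral_eq_zero_iff_of_nonneg h0 hi).1 h)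

theorem IsFeasible.eq_zero {r : ℝ → ℝ} (h : M.IsFeasible r M.p) : r = fun _ => 0 := by
  have h0 := h.integral_posterior
  rw [sub_self] at h0
  exact eq_zero_of_integral_normalLaw (σv_pos hM) h.1.piecewiseC1.1
    (integrable_of_mem_Icc h.1.piecewiseC1.1 h.1.mem_range) (fun v => (h.1.mem_range v).1) h0

/-- Indifference at `c = 0` forces posterior mean `p`, hence the full refund `r = p` everywhere. -/
theorem IsFeasible.profit_eq_zero {r : ℝ → ℝ} (h : M.IsFeasible r 0) : M.profit r 0 = 0 := by
  have h0 := h.integral_posterior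
  have hi : Integrable r (M.posterior 0) :=
    integrable_of_mem_Icc h.1.piecewiseC1.1 h.1.mem_range
  have h1 : ∫ v, (M.p - r v) ∂M.posterior 0 = 0 := by
    rw [integral_sub (integrable_const _) hi, h0, integral_const, probReal_univ, one_smul]
    ring
  have h2 := eq_zero_of_integral_normalLaw (σv_pos hM) (continuous_const.sub h.1.piecewiseC1.1)
    ((integrable_const M.p).sub hi) (fun v => sub_nonneg.2 (h.1.mem_range v).2) h1
  have h3 : ∀ v, M.p - r v = 0 := fun v => congrFun h2 v
  simp [profit, h3]

/-- A zero exists on the slope, since the ramp starts at the maximal reward and ends at the minimal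
one. There the ramp falls at the largest rate allowed to `r`, so the difference cannot decrease; off
the slope the range of `r` gives the sign. -/
theorem exists_crossing {r : ℝ → ℝ} (hr : M.IsRateConstrained r) (a : ℝ) :
    ∃ v₀, r v₀ - M.rampProgram a v₀ = 0 ∧ (∀ v < v₀, r v - M.rampProgram a v ≤ 0) ∧
      ∀ v > v₀, 0 ≤ r v - M.rampProgram a v := by
  have hw := width_pos hM
  have hL : ∀ v ≤ M.rampStart a, M.rampProgram a v = M.p := fun v hv =>
    ramp_of_nonpos hM (by linarith)
  have hH : ∀ v, M.rampStart a + M.τ * M.p ≤ v → M.rampProgram a v = 0 := fun v hv =>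
    ramp_of_ge hM (by linarith)
  have hI : ∀ v, M.rampStart a ≤ v → v ≤ M.rampStart a + M.τ * M.p →
      M.rampProgram a v = M.p - 1 / M.τ * (v - M.rampStart a) := fun v h1 h2 =>
    ramp_of_mem hM (by linarith) (by linarith)
  have hc : Continuous fun v => r v - M.rampProgram a v :=
    hr.piecewiseC1.1.sub (continuous_rampProgram a)
  obtain ⟨v₀, hv₀, h0⟩ : (0 : ℝ) ∈ (fun v => r v - M.rampProgram a v) ''
      Set.Icc (M.rampStart a) (M.rampStart a + M.τ * M.p) := by
    refine intermediate_value_Icc (by linarith) hc.continuousOn ⟨?_, ?_⟩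
    · simp only [hL _ le_rfl]; linarith [(hr.mem_range (M.rampStart a)).2]
    · simp only [hH _ le_rfl]; linarith [(hr.mem_range (M.rampStart a + M.τ * M.p)).1]
  have h0' : r v₀ - M.rampProgram a v₀ = 0 := h0
  refine ⟨v₀, h0', fun v hv => ?_, fun v hv => ?_⟩
  · rcases le_total v (M.rampStart a) with h | h
    · rw [hL v h]; linarith [(hr.mem_range v).2]
    · have := IsRateConstrained.sub_le hM hr hv.le
      rw [hI v h (by linarith [hv₀.2])]
      rw [hI v₀ hv₀.1 hv₀.2] at h0'
      linarith
  · have hv : v₀ < v := hv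
    rcases le_total (M.rampStart a + M.τ * M.p) v with h | h
    · rw [hH v h]; linarith [(hr.mem_range v).1]
    · have := IsRateConstrained.sub_le hM hr hv.le
      rw [hI v (by linarith [hv₀.1]) h]
      rw [hI v₀ hv₀.1 hv₀.2] at h0'
      linarith

theorem IsFeasible.profit_le_rampProfit {r : ℝ → ℝ} {a : ℝ}
    (h : M.IsFeasible r (M.rampCutoff a)) :
    M.profit r (M.rampCutoff a) ≤ M.rampProfit a ∧
      (M.profit r (M.rampCutoff a) = M.rampProfit a → r = M.rampProgram a) := by
  obtain ⟨v₀, h0, hlt, hgt⟩ := exists_crossing hM h.1 a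
  have hε := hM.σε_pos
  have cr := h.1.piecewiseC1.1
  have cR := continuous_rampProgram (M := M) a
  have cφ := continuous_phi
  have cΦ := continuous_Phi
  set c := M.rampCutoff a with hc
  set D : ℝ → ℝ := fun v => r v - M.rampProgram a v with hD
  -- The value of `Phi / phi` at the crossing, so that `Phi - k * phi` has the same sign pattern as
  -- `r - R`.
  set k : ℝ := Phi ((v₀ - c) / M.σε) / phi ((v₀ - c) / M.σε) with hk
  have cD : Continuous D := cr.sub cR
  have bD : ∀ v, |D v| ≤ M.p := fun v => by
    have h1 := h.1.mem_range v
    have h2 := rampProgram_mem hM a v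
    rw [abs_le]
    constructor <;> linarith [h1.1, h1.2, h2.1, h2.2]
  have hW : ∀ v, Phi ((v - c) / M.σε) - k * phi ((v - c) / M.σε) =
      phi ((v - c) / M.σε) * (Phi ((v - c) / M.σε) / phi ((v - c) / M.σε) - k) := fun v => by
    have := (phi_pos ((v - c) / M.σε)).ne'
    field_simp
  have hWlt : ∀ v < v₀, Phi ((v - c) / M.σε) - k * phi ((v - c) / M.σε) < 0 := fun v hv => by
    rw [hW]
    exact mul_neg_of_pos_of_neg (phi_pos _)
      (sub_neg.2 (strictMono_Phi_div_phi (by gcongr)))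
  have hWgt : ∀ v > v₀, 0 < Phi ((v - c) / M.σε) - k * phi ((v - c) / M.σε) := fun v hv => by
    have hv : v₀ < v := hv
    rw [hW]
    exact mul_pos (phi_pos _) (sub_pos.2 (strictMono_Phi_div_phi (by gcongr)))
  set u : ℝ → ℝ := fun v => D v * (Phi ((v - c) / M.σε) - k * phi ((v - c) / M.σε)) with hu
  have cu : Continuous u := by fun_prop
  have hu0 : ∀ v, 0 ≤ u v := fun v => by
    rcases lt_trichotomy v v₀ with hv | hv | hv
    · exact mul_nonneg_of_nonpos_of_nonpos (hlt v hv) (hWlt v hv).le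
    · simp [hu, hD, hv, h0]
    · exact mul_nonneg (hgt v hv) (hWgt v hv).le
  have i1 : Integrable (fun v => D v * (phi ((v - c) / M.σε) / M.σε)) M.qualityLaw := by
    refine Integrable.of_bound (C := M.p * (phi 0 / M.σε))
      (Continuous.aestronglyMeasurable (by fun_prop)) (Eventually.of_forall fun v => ?_)
    have h2 := phi_pos ((v - c) / M.σε)
    have h3 := hM.p_pos
    have h4 : 0 < phi ((v - c) / M.σε) / M.σε := by positivity
    rw [norm_mul, Real.norm_eq_abs, Real.norm_eq_abs, abs_of_pos h4]
    gcongr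
    · exact bD v
    · exact phi_le_phi_zero _
  have iR := integrable_profit cR (rampProgram_mem hM a) c
  have ir := integrable_profit cr h.1.mem_range c
  have eu : u = fun v => ((M.p - M.rampProgram a v) * M.salesVolume c v -
      (M.p - r v) * M.salesVolume c v) - k * M.σε * (D v * (phi ((v - c) / M.σε) / M.σε)) := by
    ext v
    simp only [hu, hD, salesVolume]
    field_simp
    ring
  have iu : Integrable u M.qualityLaw := by
    rw [eu]; exact (iR.sub ir).sub (i1.const_mul _)
  -- The `k` term drops out: by Bayes' rule it is a multiple of the posterior mean of `D`, and both
  -- programs have posterior mean `p - c`.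
  have hu_int : ∫ v, u v ∂M.qualityLaw = M.rampProfit a - M.profit r c := by
    have e1 : ∫ v, u v ∂M.qualityLaw = _ :=
      (congrArg (fun g : ℝ → ℝ => ∫ v, g v ∂M.qualityLaw) eu).trans
        (integral_sub (iR.sub ir) (i1.const_mul (k * M.σε)))
    have e2 : ∫ v, D v ∂M.posterior c = _ :=
      integral_sub (integrable_of_mem_Icc cr h.1.mem_range)
        (integrable_of_mem_Icc cR (rampProgram_mem hM a))
    rw [e1, integral_sub iR ir, integral_const_mul, integral_mul_density hM, e2, h.integral_posterior,
      integral_rampProgram hM]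
    rw [← hc, sub_self, mul_zero, mul_zero, sub_zero]
    rfl
  have hnn : 0 ≤ ∫ v, u v ∂M.qualityLaw := integral_nonneg hu0
  refine ⟨by linarith, fun heq => ?_⟩
  -- Equal profits force `u = 0`; off `v₀` its second factor is nonzero, so the programs agree.
  have hu_zero : u = 0 := eq_zero_of_integral_normalLaw hM.σθ_pos cu iu hu0 (by
    rw [heq, sub_self] at hu_int; exact hu_int)
  ext v
  have hv : u v = 0 := congrFun hu_zero v
  refine sub_eq_zero.1 ?_
  rcases lt_trichotomy v v₀ with hlt' | rfl | hgt'
  · exact (mul_eq_zero.1 hv).resolve_right (hWlt v hlt').ne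
  · exact h0
  · exact (mul_eq_zero.1 hv).resolve_right (hWgt v hgt').ne'

theorem IsFeasible.profit_cases {r : ℝ → ℝ} {c : ℝ} (h : M.IsFeasible r c) :
    M.profit r c = 0 ∨ M.profit r c = M.profit (fun _ => 0) M.p ∨ ∃ a, c = M.rampCutoff a := by
  obtain ⟨h0, h1⟩ := h.cutoff_mem
  rcases h0.eq_or_lt with rfl | h0
  · exact Or.inl (IsFeasible.profit_eq_zero hM h)
  rcases h1.eq_or_lt with rfl | h1
  · rw [IsFeasible.eq_zero hM h]; exact Or.inr (Or.inl rfl)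
  obtain ⟨a, ha⟩ := exists_expectedRamp_eq hM (y := M.p - c) (by linarith) (by linarith)
  exact Or.inr (Or.inr ⟨a, by rw [rampCutoff, ha]; ring⟩)

theorem solvesSystem_of_deriv_eq_zero {a : ℝ} (h : deriv M.rampProfit a = 0) :
    M.SolvesSystem (M.rampCutoff a) (M.rampStart a) (M.rampStart a + M.τ * M.p) := by
  have eL : M.rampStart a - M.μ (M.rampCutoff a) = a := rampStart_sub_μ a
  have eH : M.rampStart a + M.τ * M.p - M.μ (M.rampCutoff a) = a + M.τ * M.p := by linarith
  refine ⟨?_, by ring, ?_⟩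
  · have hP := slopeMass_pos hM a
    have hP1 := slopeMass_lt_one (M := M) a
    rw [(hasDerivAt_rampProfit hM a).deriv] at h
    have h' := (mul_eq_zero.1 h).resolve_left (one_div_pos.2 (τ_pos hM)).ne'
    rw [eL, eH]
    change M.rampSales a / M.slopeMass a = _
    rw [show 1 + Phi (a / M.σv) - Phi ((a + M.τ * M.p) / M.σv) = 1 - M.slopeMass a by
      rw [slopeMass]; ring, div_eq_div_iff hP.ne' (by linarith)]
    linarith
  · rw [eL, eH, ← expectedRamp_eq hM, rampCutoff]
    ring

end Comparison

end Market

end RewardProgram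

end

theorem theorem3 (M : RewardProgram.Market) (hθ : 0 < M.σθ) (hε : 0 < M.σε) (hp : 0 < M.p) :
    (∃ (r : ℝ → ℝ) (c : ℝ), M.IsOptimal r c) ∧
    ∀ (r : ℝ → ℝ) (c : ℝ), M.IsOptimal r c →
      ∃ vL vH : ℝ, r = M.saturatedLinear vL vH ∧ M.SolvesSystem c vL vH := by
  have hM : M.IsPositive := ⟨hθ, hε, hp⟩
  obtain ⟨a₀, hmax, hpos, hlt⟩ := RewardProgram.Market.exists_rampProfit_max hM
  have hfeas := RewardProgram.Market.isFeasible_rampProgram hM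
  refine ⟨⟨M.rampProgram a₀, M.rampCutoff a₀, hfeas a₀, fun r c h => ?_⟩, fun r c h => ?_⟩
  · rcases RewardProgram.Market.IsFeasible.profit_cases hM h with h0 | h0 | ⟨a, rfl⟩
    · exact h0.trans_le hpos.le
    · exact h0.trans_le hlt.le
    · exact (RewardProgram.Market.IsFeasible.profit_le_rampProfit hM h).1.trans (hmax a)
  · have hge : M.rampProfit a₀ ≤ M.profit r c := h.2 _ _ (hfeas a₀)
    rcases RewardProgram.Market.IsFeasible.profit_cases hM h.1 with h0 | h0 | ⟨a, rfl⟩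
    · exact absurd (h0 ▸ hge) (not_le.2 hpos)
    · exact absurd (h0 ▸ hge) (not_le.2 hlt)
    · obtain ⟨h1, h2⟩ := RewardProgram.Market.IsFeasible.profit_le_rampProfit hM h.1
      have ha : M.rampProfit a = M.rampProfit a₀ :=
        le_antisymm (hmax a) (hge.trans h1)
      -- The ramp sharing the cutoff of an optimal pair is itself a maximizer in `a`, so the
      -- first-order condition holds at its own parameter, which need not be `a₀`.
      have hloc : IsLocalMax M.rampProfit a :=
        Filter.Eventually.of_forall fun b => (hmax b).trans ha.ge
      refine ⟨M.rampStart a, M.rampStart a + M.τ * M.p, ?_,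
        RewardProgram.Market.solvesSystem_of_deriv_eq_zero hM hloc.deriv_eq_zero⟩
      rw [RewardProgram.Market.saturatedLinear_rampStart hM]
      exact h2 (le_antisymm h1 (ha.le.trans hge))
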